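/- Let $m,r\ge 0$ and $k\ge 1$ be integers and let $\beta=(\beta_1,\dots,\beta_m)$ be a sequence of non-negative integers. Let $\mathcal{OP}^{\mathrm{all}}_{r;\beta,k}$ be the set of ordered multiset partitions $B_1/\cdots/B_k$ of the multiset $\{0^r,1^{\beta_1},\dots,m^{\beta_m}\}$ into $k$ nonempty blocks, where no block contains a repeated element, and let $\mathcal{OP}_{r;\beta,k}$ be the subset of those with $0\notin B_k$. (For $k=0$, $\mathcal{OP}^{\mathrm{all}}_{r;\beta,0}$ consists of the empty partition if $r=0$ and $\beta=0$, and is empty otherwise.) For $\pi=B_1/\cdots/B_k$, let $\mathrm{miniword}(\pi)$ be the word obtained as follows: write $B_k$ in increasing order; then, for $i=k-1,\dots,1$, write to the left of the word already built first the elements of $B_i$ strictly larger than the first letter of that word, in increasing order, and then the remaining elements of $B_i$, in increasing order. For a word $w=w_1w_2\cdots$ let $\mathrm{maj}(w)=\sum_{i:\,w_i>w_{i+1}} i$, and put $\mathrm{minimaj}(\pi)=\mathrm{maj}(\mathrm{miniword}(\pi))$. Let $\mathrm{inv}(\pi)$ be the number of pairs of entries $a>b$ of $\pi$ such that $b$ is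 the minimum of its block and $a$ lies in a block strictly to the left of the block of $b$. Put $$M_{r;\beta,k}(q)=\sum_{\pi\in\mathcal{OP}_{r;\beta,k}}q^{\mathrm{minimaj}(\pi)},\quad M^{\mathrm{all}}_{r;\beta,k}(q)=\sum_{\pi\in\mathcal{OP}^{\mathrm{all}}_{r;\beta,k}}q^{\mathrm{minimaj}(\pi)},$$ and define $I_{r;\beta,k}(q)$ and $I^{\mathrm{all}}_{r;\beta,k}(q)$ in the same way with $\mathrm{inv}$ in place of $\mathrm{minimaj}$. For $S\subseteq[m]=\{1,\dots,m\}$ let $\chi_S\in\{0,1\}^m$ be its indicator sequence; $\chi_S\le\beta$ is meant entrywise. **Theorem.** The generating function of minimaj satisfies $$M_{r;\beta,k}(q)=\sum_{\substack{\emptyset\ne S\subseteq[m]\\ \chi_S\le\beta}} q^{\sum_{i=\min(S)+1}^{m}(\beta_i-\chi_S(i))}\,M^{\mathrm{all}}_{r;\beta-\chi_S,k-1}(q),$$ and the generating function of inv satisfies the same recursion: $$I_{r;\beta,k}(q)=\sum_{\substack{\emptyset\ne S\subseteq[m]\\ \chi_S\le\beta}} q^{\sum_{i=\min(S)+1}^{m}(\beta_i-\chi_S(i))}\,I^{\mathrm{all}}_{r;\beta-\chi_S,k-1}(q).$$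 -/

import Mathlib

open Polynomial

namespace OMP

/-- The multiset `A(β) ∪ {0^r}`. The alphabet is `{0, 1, …, m} = Fin (m + 1)`;
the entry `β i`, for `i : Fin m`, is the multiplicity of the letter `i.succ`. -/
def multisetA {m : ℕ} (r : ℕ) (β : Fin m → ℕ) : Multiset (Fin (m + 1)) :=
  Multiset.replicate r 0 + ∑ i : Fin m, Multiset.replicate (β i) i.succ

/-- `π` lists the blocks of an ordered multiset partition of `A(β) ∪ {0^r}` into `k`
(nonempty, repetition-free) blocks; `0` may occur in any block. -/
def IsPartitionAll {m k : ℕ} (r : ℕ) (β : Fin m → ℕ) (π : Fin k → Finset (Fin (m + 1))) : Prop :=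
  (∀ i, (π i).Nonempty) ∧ ∑ i, (π i).val = multisetA r β

/-- Extended ordered multiset partitions: `0` does not occur in the last block. -/
def IsPartition {m k : ℕ} (r : ℕ) (β : Fin m → ℕ) (π : Fin k → Finset (Fin (m + 1))) : Prop :=
  IsPartitionAll r β π ∧ ∀ i : Fin k, i.val + 1 = k → 0 ∉ π i

instance {m k : ℕ} (r : ℕ) (β : Fin m → ℕ) :
    DecidablePred (IsPartitionAll (k := k) r β) := fun π => by
  unfold IsPartitionAll
  infer_instance

instance {m k : ℕ} (r : ℕ) (β : Fin m → ℕ) :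
    DecidablePred (IsPartition (k := k) r β) := fun π => by
  unfold IsPartition
  infer_instance

/-- The word obtained by organizing the blocks of a list of blocks from right to left: the last
block is written increasingly; any other block is written as its letters that are strictly bigger
than the first letter `a` of the word formed by the later blocks, increasingly, followed by its
remaining letters, increasingly. -/
def miniwordList {n : ℕ} : List (Finset (Fin n)) → List (Fin n)
  | [] => []
  | B :: rest =>
    match miniwordList rest with
    | [] => B.sort (· ≤ ·)
    | a :: w =>
      (B.filter (fun x => a < x)).sort (· ≤ ·) ++ (B.filter (fun x => x ≤ a)).sort (· ≤ ·) ++ a :: w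

def miniword {n k : ℕ} (π : Fin k → Finset (Fin n)) : List (Fin n) :=
  miniwordList (List.ofFn π)

/-- The major index of a word `w₁ w₂ ⋯`: the sum of the positions `i` (counted from `1`) with
`w_i > w_{i+1}`. -/
def majWord {n : ℕ} (w : List (Fin n)) : ℕ :=
  ∑ i : Fin (w.length - 1),
    if w.get ⟨i.val + 1, by omega⟩ < w.get ⟨i.val, by omega⟩ then i.val + 1 else 0

def minimaj {n k : ℕ} (π : Fin k → Finset (Fin n)) : ℕ :=
  majWord (miniword π)

/-- The number of inversion pairs: pairs of entries `a > b` (`a` in block `i`, `b` in block `j`)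
such that `b` is the minimum of its block and `a` lies in a block strictly to the left. -/
def inv {n k : ℕ} (π : Fin k → Finset (Fin n)) : ℕ :=
  (Finset.univ.filter (fun p : (Fin k × Fin n) × (Fin k × Fin n) =>
    p.1.1 < p.2.1 ∧ p.1.2 ∈ π p.1.1 ∧ (π p.2.1).min = p.2.2 ∧ p.2.2 < p.1.2)).card

/-- The generating function `M_{r;β,k}(q)`. -/
noncomputable def M {m : ℕ} (r : ℕ) (β : Fin m → ℕ) (k : ℕ) : ℕ[X] :=
  ∑ π : Fin k → Finset (Fin (m + 1)) with IsPartition r β π, X ^ minimaj π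

/-- The generating function of minimaj where `0` is allowed in the last block. -/
noncomputable def Mall {m : ℕ} (r : ℕ) (β : Fin m → ℕ) (k : ℕ) : ℕ[X] :=
  ∑ π : Fin k → Finset (Fin (m + 1)) with IsPartitionAll r β π, X ^ minimaj π

/-- The generating function `I_{r;β,k}(q)`. -/
noncomputable def I {m : ℕ} (r : ℕ) (β : Fin m → ℕ) (k : ℕ) : ℕ[X] :=
  ∑ π : Fin k → Finset (Fin (m + 1)) with IsPartition r β π, X ^ inv π

/-- The generating function of inv where `0` is allowed in the last block. -/
noncomputable def Iall {m : ℕ} (r : ℕ) (β : Fin m → ℕ) (k : ℕ) : ℕ[X] :=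
  ∑ π : Fin k → Finset (Fin (m + 1)) with IsPartitionAll r β π, X ^ inv π

/-- The indicator sequence `χ_S`. -/
def chi {m : ℕ} (S : Finset (Fin m)) : Fin m → ℕ := fun i => if i ∈ S then 1 else 0

/-- The exponent `∑_{i > min S} (β_i - χ_S(i))`. -/
def lastBlockExponent {m : ℕ} (β : Fin m → ℕ) (S : Finset (Fin m)) : ℕ :=
  ∑ i ∈ Finset.univ.filter (fun i : Fin m => S.min < WithTop.some i), (β i - chi S i)

end OMP

/-!
Record the letters of an ordered multiset partition by commuting variables `x_i`. In the generating
polynomial of all sequences of `k` nonempty blocks, appending a last block `S` multiplies by `x^S`;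
`inv` grows by the number of earlier entries larger than `min S`, which is the effect of the
substitution `x_i ↦ q x_i` for `i > min S`. This is the recursion for `inv`.

For `minimaj` the same number of entries appears, but what remains is the `minimaj` of the earlier
blocks after the cyclic relabelling `x ↦ x - (min S + 1)` of the alphabet: the miniword is sorted
with respect to the cyclic order that starts right after `min S`. So the recursion is the same
provided that the generating polynomial is symmetric in the `x_i`, which is proved by induction
on `k` together with a difference equation. If `D_i F = ((1 + x_i) F(q x_i) - F) / x_i` is the same
polynomial for all `i`, then this remains true after appending a block, and the common difference of
the new polynomial is symmetric if `F` is; it determines the new polynomial, which is therefore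
symmetric as well.
-/

namespace OMP

section BlockOperators

variable {σ τ R : Type*} [CommSemiring R]

variable (R) in
/-- The monomial `x^B = ∏ i ∈ B, x_i` recording the letters of a block `B`. -/
noncomputable def blockMonomial (B : Finset σ) : MvPolynomial σ R :=
  ∏ i ∈ B, MvPolynomial.X i

theorem blockMonomial_insert [DecidableEq σ] {i : σ} {B : Finset σ} (hi : i ∉ B) :
    blockMonomial R (insert i B) = MvPolynomial.X i * blockMonomial R B :=
  Finset.prod_insert hi

theorem rename_blockMonomial (e : σ ↪ τ) (B : Finset σ) :
    MvPolynomial.rename e (blockMonomial R B) = blockMonomial R (B.map e) := by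
  simp [blockMonomial, map_prod]

theorem blockMonomial_eq_monomial [DecidableEq σ] (B : Finset σ) :
    blockMonomial R B = MvPolynomial.monomial (Multiset.toFinsupp B.val) 1 := by
  induction B using Finset.induction_on with
  | empty => simp [blockMonomial]
  | insert i B hi ih =>
    rw [blockMonomial_insert hi, ih, Finset.insert_val_of_notMem hi, ← Multiset.singleton_add,
      Multiset.toFinsupp_add, Multiset.toFinsupp_singleton, MvPolynomial.X,
      MvPolynomial.monomial_mul, one_mul]

theorem prod_blockMonomial {ι : Type*} [DecidableEq σ] (s : Finset ι) (π : ι → Finset σ) :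
    ∏ i ∈ s, blockMonomial R (π i) =
      MvPolynomial.monomial (Multiset.toFinsupp (∑ i ∈ s, (π i).val)) 1 := by
  simp only [blockMonomial_eq_monomial, map_sum, ← MvPolynomial.monomial_sum_one]

variable [DecidableEq σ] [DecidableEq τ]

/-- The substitution `x_i ↦ q x_i` for `i ∈ U`: every letter in `U` is given the weight `q`. -/
noncomputable def scale (q : R) (U : Finset σ) : MvPolynomial σ R →ₐ[R] MvPolynomial σ R :=
  MvPolynomial.aeval fun i => (if i ∈ U then q else 1) • MvPolynomial.X i

theorem scale_X (q : R) (U : Finset σ) (i : σ) :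
    scale q U (MvPolynomial.X i) = (if i ∈ U then q else 1) • MvPolynomial.X i :=
  MvPolynomial.aeval_X _ i

theorem scale_X_of_notMem (q : R) {U : Finset σ} {i : σ} (hi : i ∉ U) :
    scale q U (MvPolynomial.X i) = MvPolynomial.X i := by
  rw [scale_X, if_neg hi, one_smul]

theorem scale_empty (q : R) (F : MvPolynomial σ R) : scale q ∅ F = F := by
  simp [scale]

theorem scale_comm (q : R) (U V : Finset σ) (F : MvPolynomial σ R) :
    scale q U (scale q V F) = scale q V (scale q U F) := by
  refine DFunLike.congr_fun (f := (scale q U).comp (scale q V)) (g := (scale q V).comp (scale q U))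
    (MvPolynomial.algHom_ext fun i => ?_) F
  simp only [AlgHom.comp_apply, scale_X, map_smul]
  exact smul_comm _ _ _

theorem scale_insert (q : R) {i : σ} {U : Finset σ} (hi : i ∉ U) (F : MvPolynomial σ R) :
    scale q (insert i U) F = scale q {i} (scale q U F) := by
  refine DFunLike.congr_fun (g := (scale q {i}).comp (scale q U))
    (MvPolynomial.algHom_ext fun j => ?_) F
  by_cases hj : j = i
  · simp only [AlgHom.comp_apply, scale_X, hj, hi, Finset.mem_insert_self, Finset.mem_singleton,
      if_true, if_false, one_smul]
  · simp only [AlgHom.comp_apply, scale_X, map_smul, Finset.mem_insert, Finset.mem_singleton, hj,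
      false_or, if_false, one_smul]

theorem scale_blockMonomial (q : R) (U B : Finset σ) :
    scale q U (blockMonomial R B) = q ^ (B.filter (· ∈ U)).card • blockMonomial R B := by
  rw [blockMonomial, map_prod]
  simp only [scale_X]
  rw [Finset.prod_smul, Finset.prod_ite, Finset.prod_const, Finset.prod_const_one, mul_one]

theorem scale_prod_blockMonomial {ι : Type*} (q : R) (U : Finset σ) (s : Finset ι)
    (π : ι → Finset σ) :
    scale q U (∏ i ∈ s, blockMonomial R (π i)) =
      q ^ (∑ i ∈ s, ((π i).filter (· ∈ U)).card) • ∏ i ∈ s, blockMonomial R (π i) := by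
  simp only [map_prod, scale_blockMonomial, Finset.prod_smul, Finset.prod_pow_eq_pow_sum]

theorem scale_blockMonomial_of_disjoint (q : R) {U B : Finset σ} (h : Disjoint B U) :
    scale q U (blockMonomial R B) = blockMonomial R B := by
  rw [scale_blockMonomial, Finset.filter_mem_eq_inter, Finset.disjoint_iff_inter_eq_empty.1 h,
    Finset.card_empty, pow_zero, one_smul]

theorem coeff_scale (q : R) (U : Finset σ) (F : MvPolynomial σ R) (d : σ →₀ ℕ) :
    (scale q U F).coeff d = q ^ (∑ i ∈ U, d i) * F.coeff d := by
  induction F using MvPolynomial.induction_on' with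
  | add F G hF hG => simp only [map_add, MvPolynomial.coeff_add, hF, hG, mul_add]
  | monomial e a =>
    have scale_monomial : scale q U (MvPolynomial.monomial e a) =
        MvPolynomial.monomial e (q ^ (∑ i ∈ U, e i) * a) := by
      have weight : ∏ i ∈ e.support, (if i ∈ U then q else 1) ^ e i = q ^ ∑ i ∈ U, e i := by
        simp only [ite_pow, one_pow]
        rw [Finset.prod_ite_mem, ← Finset.prod_pow_eq_pow_sum]
        refine Finset.prod_subset Finset.inter_subset_right fun i hi hi' => ?_
        rw [show e i = 0 by simpa [hi] using hi', pow_zero]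
      rw [scale, MvPolynomial.aeval_monomial, Finsupp.prod]
      simp only [_root_.smul_pow, Finset.prod_smul, weight]
      rw [mul_smul_comm, ← smul_eq_mul (q ^ _), ← MvPolynomial.smul_monomial,
        MvPolynomial.monomial_eq]
      rfl
    rw [scale_monomial, MvPolynomial.coeff_monomial, MvPolynomial.coeff_monomial]
    split_ifs with h
    · rw [h]
    · rw [mul_zero]

theorem rename_scale (q : R) (e : σ ↪ τ) (U : Finset σ) (F : MvPolynomial σ R) :
    MvPolynomial.rename e (scale q U F) = scale q (U.map e) (MvPolynomial.rename e F) := by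
  refine DFunLike.congr_fun (f := (MvPolynomial.rename e).comp (scale q U))
    (g := (scale q (U.map e)).comp (MvPolynomial.rename e))
    (MvPolynomial.algHom_ext fun i => ?_) F
  simp only [AlgHom.comp_apply, scale_X, map_smul, MvPolynomial.rename_X, Finset.mem_map']

/-- Appends a possibly empty last block contained in `U` in all possible ways, where each letter
of `U` in the earlier blocks is given the weight `q`: this is `∑ S ⊆ U, x^S · scale q U F`. -/
noncomputable def appendSubset (q : R) (U : Finset σ) : MvPolynomial σ R →ₗ[R] MvPolynomial σ R :=
  LinearMap.mulLeft R (∏ i ∈ U, (1 + MvPolynomial.X i)) ∘ₗ (scale q U).toLinearMap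

theorem appendSubset_apply (q : R) (U : Finset σ) (F : MvPolynomial σ R) :
    appendSubset q U F = (∏ i ∈ U, (1 + MvPolynomial.X i)) * scale q U F :=
  rfl

theorem appendSubset_eq_sum (q : R) (U : Finset σ) (F : MvPolynomial σ R) :
    appendSubset q U F = ∑ S ∈ U.powerset, blockMonomial R S * scale q U F := by
  rw [appendSubset_apply, Finset.prod_one_add, Finset.sum_mul]
  rfl

theorem appendSubset_empty (q : R) (F : MvPolynomial σ R) : appendSubset q ∅ F = F := by
  rw [appendSubset_apply, Finset.prod_empty, one_mul, scale_empty]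

theorem appendSubset_singleton (q : R) (i : σ) (F : MvPolynomial σ R) :
    appendSubset q {i} F = (1 + MvPolynomial.X i) * scale q {i} F := by
  rw [appendSubset_apply, Finset.prod_singleton]

theorem appendSubset_insert (q : R) {i : σ} {U : Finset σ} (hi : i ∉ U) (F : MvPolynomial σ R) :
    appendSubset q (insert i U) F = appendSubset q U (appendSubset q {i} F) := by
  have hU : scale q U (1 + MvPolynomial.X i) = 1 + MvPolynomial.X i := by
    rw [map_add, map_one, scale_X_of_notMem q hi]
  rw [appendSubset_singleton, appendSubset_apply, appendSubset_apply, map_mul, hU,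
    Finset.prod_insert hi, scale_insert q hi, scale_comm]
  ring

theorem appendSubset_X_mul_of_notMem (q : R) {i : σ} {U : Finset σ} (hi : i ∉ U)
    (F : MvPolynomial σ R) :
    appendSubset q U (MvPolynomial.X i * F) = MvPolynomial.X i * appendSubset q U F := by
  rw [appendSubset_apply, appendSubset_apply, map_mul, scale_X_of_notMem q hi]
  ring

theorem appendSubset_X_mul_of_mem (q : R) {i : σ} {U : Finset σ} (hi : i ∈ U)
    (F : MvPolynomial σ R) :
    appendSubset q U (MvPolynomial.X i * F) = q • (MvPolynomial.X i * appendSubset q U F) := by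
  rw [appendSubset_apply, appendSubset_apply, map_mul, scale_X, if_pos hi, smul_mul_assoc,
    mul_smul_comm, mul_left_comm]

theorem appendSubset_singleton_comm (q : R) (i : σ) (U : Finset σ) (F : MvPolynomial σ R) :
    appendSubset q {i} (appendSubset q U F) = appendSubset q U (appendSubset q {i} F) := by
  have of_notMem {V : Finset σ} (hi : i ∉ V) (G : MvPolynomial σ R) :
      appendSubset q {i} (appendSubset q V G) = appendSubset q V (appendSubset q {i} G) := by
    have hV : scale q {i} (∏ j ∈ V, (1 + MvPolynomial.X j)) =
        ∏ j ∈ V, (1 + MvPolynomial.X j : MvPolynomial σ R) := by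
      rw [map_prod]
      refine Finset.prod_congr rfl fun j hj => ?_
      rw [map_add, map_one, scale_X_of_notMem]
      simpa using ne_of_mem_of_not_mem hj hi
    rw [← appendSubset_insert q hi, appendSubset_singleton, appendSubset_apply, appendSubset_apply,
      map_mul, hV, Finset.prod_insert hi, scale_insert q hi, mul_assoc]
  by_cases hi : i ∈ U
  · rw [← Finset.insert_erase hi, appendSubset_insert q (U.notMem_erase i),
      appendSubset_insert q (U.notMem_erase i), of_notMem (U.notMem_erase i)]
  · exact of_notMem hi F

theorem rename_appendSubset (q : R) (e : σ ↪ τ) (U : Finset σ) (F : MvPolynomial σ R) :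
    MvPolynomial.rename e (appendSubset q U F) =
      appendSubset q (U.map e) (MvPolynomial.rename e F) := by
  rw [appendSubset_apply, appendSubset_apply, map_mul, map_prod, Finset.prod_map, rename_scale]
  simp only [map_add, map_one, MvPolynomial.rename_X]

end BlockOperators

section AppendBlock

variable {σ R : Type*} [LinearOrder σ] [CommSemiring R]

/-- Appends a nonempty last block `S ⊆ s` in all possible ways, where each letter of `s` larger
than `min S` in the earlier blocks is given the weight `q`. -/
noncomputable def appendBlock (q : R) (s : Finset σ) : MvPolynomial σ R →ₗ[R] MvPolynomial σ R :=
  ∑ S ∈ s.powerset with S.Nonempty,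
    LinearMap.mulLeft R (blockMonomial R S) ∘ₗ
      (scale q (s.filter fun j : σ => S.min < j)).toLinearMap

theorem appendBlock_apply (q : R) (s : Finset σ) (F : MvPolynomial σ R) :
    appendBlock q s F =
      ∑ S ∈ s.powerset with S.Nonempty,
        blockMonomial R S * scale q (s.filter fun j : σ => S.min < j) F := by
  simp [appendBlock, LinearMap.sum_apply]

theorem appendBlock_empty (q : R) (F : MvPolynomial σ R) : appendBlock q ∅ F = 0 := by
  simp [appendBlock_apply, Finset.filter_singleton]

theorem appendBlock_insert (q : R) {a : σ} {s : Finset σ} (ha : ∀ i ∈ s, a < i)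
    (F : MvPolynomial σ R) :
    appendBlock q (insert a s) F =
      MvPolynomial.X a * appendSubset q s F + appendBlock q s F := by
  have ha' : a ∉ s := fun h => lt_irrefl a (ha a h)
  have with_a {S : Finset σ} (hS : S ⊆ s) :
      (insert a s).filter (fun j : σ => (insert a S).min < j) = s := by
    have hmin : (insert a S).min = a := by
      rw [Finset.min_insert, min_eq_left]
      exact Finset.le_min fun i hi => WithTop.coe_le_coe.2 (ha i (hS hi)).le
    simp only [hmin, WithTop.coe_lt_coe, Finset.filter_insert, lt_irrefl, if_false]
    exact Finset.filter_true_of_mem ha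
  have without_a {S : Finset σ} (hS : S ⊆ s) (hne : S.Nonempty) :
      (insert a s).filter (fun j : σ => S.min < j) = s.filter fun j : σ => S.min < j := by
    refine (Finset.filter_insert ..).trans (if_neg ?_)
    rw [← Finset.coe_min' hne, WithTop.coe_lt_coe, not_lt]
    exact (ha _ (hS (S.min'_mem hne))).le
  rw [appendBlock_apply, appendBlock_apply, Finset.sum_filter, Finset.sum_filter,
    Finset.sum_powerset_insert ha', add_comm, appendSubset_eq_sum, Finset.mul_sum]
  refine congrArg₂ (· + ·) (Finset.sum_congr rfl fun S hS => ?_)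
    (Finset.sum_congr rfl fun S hS => ?_) <;> rw [Finset.mem_powerset] at hS
  · rw [if_pos (Finset.insert_nonempty a S), with_a hS, blockMonomial_insert fun h => ha' (hS h),
      mul_assoc]
  · by_cases hne : S.Nonempty
    · rw [if_pos hne, if_pos hne, without_a hS hne]
    · rw [if_neg hne, if_neg hne]

theorem appendBlock_X_mul (q : R) {i : σ} {s : Finset σ} (hi : i ∉ s) (F : MvPolynomial σ R) :
    appendBlock q s (MvPolynomial.X i * F) = MvPolynomial.X i * appendBlock q s F := by
  simp only [appendBlock_apply, Finset.mul_sum]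
  refine Finset.sum_congr rfl fun S _ => ?_
  rw [map_mul, scale_X_of_notMem q fun h => hi (Finset.mem_filter.1 h).1]
  ring

theorem appendBlock_appendSubset_singleton (q : R) {i : σ} {s : Finset σ} (hi : i ∉ s)
    (F : MvPolynomial σ R) :
    appendBlock q s (appendSubset q {i} F) = appendSubset q {i} (appendBlock q s F) := by
  have hscale : scale q {i} (appendBlock q s F) = appendBlock q s (scale q {i} F) := by
    simp only [appendBlock_apply, map_sum, map_mul]
    refine Finset.sum_congr rfl fun S hS => ?_
    have hiS : i ∉ S := fun h => hi (Finset.mem_powerset.1 (Finset.mem_filter.1 hS).1 h)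
    rw [scale_blockMonomial_of_disjoint q (Finset.disjoint_singleton_right.2 hiS), scale_comm]
  rw [appendSubset_singleton, appendSubset_singleton, hscale, one_add_mul, one_add_mul, map_add,
    appendBlock_X_mul q hi]

/-- The generating function `blockGen q k` of sequences of `k` nonempty blocks. -/
noncomputable def blockGen [Fintype σ] (q : R) : ℕ → MvPolynomial σ R
  | 0 => 1
  | k + 1 => appendBlock q Finset.univ (blockGen q k)

end AppendBlock

section Symmetry

variable {σ R : Type*} [CommRing R]

/-- All the difference quotients of `F` along the operators `appendSubset q {i}`, `i ∈ s`, are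
equal to `H`. -/
def HasDifference [DecidableEq σ] (q : R) (s : Finset σ) (F H : MvPolynomial σ R) : Prop :=
  ∀ i ∈ s, appendSubset q {i} F = F + MvPolynomial.X i * H

theorem HasDifference.rename [Fintype σ] [DecidableEq σ] {q : R} {F H : MvPolynomial σ R}
    (h : HasDifference q Finset.univ F H) (e : Equiv.Perm σ) :
    HasDifference q Finset.univ (MvPolynomial.rename e F) (MvPolynomial.rename e H) := by
  intro i _
  have hi := congrArg (MvPolynomial.rename e) (h (e.symm i) (Finset.mem_univ _))
  rwa [map_add, map_mul, MvPolynomial.rename_X, e.apply_symm_apply, ← e.coe_toEmbedding,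
    rename_appendSubset, Finset.map_singleton, e.coe_toEmbedding, e.apply_symm_apply] at hi

/-- Compare coefficients at `x_i x^d`, where `x^d` is a monomial of maximal degree in
`F - G`. -/
theorem HasDifference.unique [DecidableEq σ] [IsDomain R] {q : R} (hq : q ≠ 0) {s : Finset σ}
    (hs : s.Nonempty) {F G H : MvPolynomial σ R} (hF : HasDifference q s F H)
    (hG : HasDifference q s G H) : F = G := by
  obtain ⟨i, hi⟩ := hs
  by_contra hne
  obtain ⟨d, hd, hmax⟩ := (F - G).support.exists_max_image Finsupp.degree
    (MvPolynomial.support_nonempty.2 (sub_ne_zero.2 hne))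
  have fixed : appendSubset q {i} (F - G) = F - G := by
    rw [map_sub, hF i hi, hG i hi, add_sub_add_right_eq_sub]
  have top : (F - G).coeff (Finsupp.single i 1 + d) = 0 := by
    by_contra h
    have hle := hmax _ (MvPolynomial.mem_support_iff.2 h)
    rw [map_add, Finsupp.degree_single] at hle
    omega
  have hcoeff := congrArg (MvPolynomial.coeff (Finsupp.single i 1 + d)) fixed
  rw [appendSubset_singleton, one_add_mul, MvPolynomial.coeff_add, MvPolynomial.coeff_X_mul,
    coeff_scale, coeff_scale, top, mul_zero, zero_add] at hcoeff
  exact mul_ne_zero (pow_ne_zero _ hq) (MvPolynomial.mem_support_iff.1 hd) hcoeff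

theorem HasDifference.appendSubset_self [DecidableEq σ] {q : R} {s : Finset σ}
    {F H : MvPolynomial σ R} (h : HasDifference q s F H) :
    HasDifference q s (appendSubset q s F) (q • appendSubset q s H) := by
  intro i hi
  rw [appendSubset_singleton_comm, h i hi, map_add, appendSubset_X_mul_of_mem q hi, mul_smul_comm]

variable [LinearOrder σ]

theorem HasDifference.appendBlock_difference {q : R} {s : Finset σ} {F H : MvPolynomial σ R}
    (h : HasDifference q s F H) : appendBlock q s H = appendSubset q s F - F := by
  induction s using Finset.induction_on_min with
  | empty => rw [appendBlock_empty, appendSubset_empty, sub_self]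
  | insert a s ha ih =>
    have ha' : a ∉ s := fun h => lt_irrefl a (ha a h)
    rw [appendBlock_insert q ha, ih fun i hi => h i (Finset.mem_insert_of_mem hi),
      ← appendSubset_X_mul_of_notMem q ha', appendSubset_insert q ha',
      h a (Finset.mem_insert_self a s), map_add]
    ring

theorem HasDifference.appendBlock_self {q : R} {s : Finset σ} {F H : MvPolynomial σ R}
    (h : HasDifference q s F H) :
    HasDifference q s (appendBlock q s F) (q • appendSubset q s F - F) := by
  induction s using Finset.induction_on_min with
  | empty => exact fun i hi => absurd hi (Finset.notMem_empty i)
  | insert a s ha ih =>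
    have ha' : a ∉ s := fun h => lt_irrefl a (ha a h)
    have hs : HasDifference q s F H := fun i hi => h i (Finset.mem_insert_of_mem hi)
    have diff_a := h a (Finset.mem_insert_self a s)
    have step_a : appendSubset q (insert a s) F =
        appendSubset q s F + MvPolynomial.X a * appendSubset q s H := by
      rw [appendSubset_insert q ha', diff_a, map_add, appendSubset_X_mul_of_notMem q ha']
    intro i hi
    rw [appendBlock_insert q ha, map_add]
    rcases Finset.mem_insert.1 hi with rfl | hi
    · rw [appendSubset_X_mul_of_mem q (Finset.mem_singleton_self i), appendSubset_singleton_comm,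
        ← appendSubset_insert q ha', ← appendBlock_appendSubset_singleton q ha', diff_a, map_add,
        appendBlock_X_mul q ha', hs.appendBlock_difference]
      simp only [MvPolynomial.smul_eq_C_mul]
      ring
    · have hia : a ∉ ({i} : Finset σ) := by simpa using (ha i hi).ne
      rw [appendSubset_X_mul_of_notMem q hia, hs.appendSubset_self i hi, ih hs i hi, step_a]
      simp only [MvPolynomial.smul_eq_C_mul]
      ring

theorem isSymmetric_blockGen [Fintype σ] [IsDomain R] {q : R} (hq : q ≠ 0) (k : ℕ) :
    (blockGen q k : MvPolynomial σ R).IsSymmetric := by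
  suffices key : (blockGen q k : MvPolynomial σ R).IsSymmetric ∧
      ∃ H, HasDifference q Finset.univ (blockGen q k : MvPolynomial σ R) H from key.1
  induction k with
  | zero =>
    refine ⟨MvPolynomial.IsSymmetric.one, 1, fun i _ => ?_⟩
    rw [blockGen, appendSubset_singleton, map_one, mul_one, mul_one]
  | succ k ih =>
    obtain ⟨hsymm, H, hH⟩ := ih
    have hdiff := hH.appendBlock_self
    refine ⟨fun e => ?_, _, hdiff⟩
    rcases isEmpty_or_nonempty σ with hσ | ⟨⟨i⟩⟩
    · rw [Subsingleton.elim e 1]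
      exact MvPolynomial.rename_id_apply _
    · have hsymm' : MvPolynomial.rename e
          (q • appendSubset q Finset.univ (blockGen q k) - blockGen q k : MvPolynomial σ R) =
          q • appendSubset q Finset.univ (blockGen q k) - blockGen q k := by
        rw [map_sub, map_smul, ← e.coe_toEmbedding, rename_appendSubset, Finset.map_univ_equiv,
          e.coe_toEmbedding, hsymm e]
      exact HasDifference.unique hq ⟨i, Finset.mem_univ i⟩ (hsymm' ▸ hdiff.rename e) hdiff

end Symmetry

section Words

variable {m n : ℕ}

/-- The letters of a block, listed in the cyclic order starting right after `h`. -/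
def blockWord (h : Fin n) (B : Finset (Fin n)) : List (Fin n) :=
  (B.filter (fun x => h < x)).sort (· ≤ ·) ++ (B.filter (fun x => x ≤ h)).sort (· ≤ ·)

/-- The part of the miniword coming from the blocks of a list when these blocks are followed by a
word with first letter `a`. -/
def wordBefore (a : Fin n) : List (Finset (Fin n)) → List (Fin n)
  | [] => []
  | B :: rest => blockWord ((wordBefore a rest).headD a) B ++ wordBefore a rest

theorem miniwordList_append_singleton {S : Finset (Fin n)} {a : Fin n} {t : List (Fin n)}
    (hS : S.sort (· ≤ ·) = a :: t) (L : List (Finset (Fin n))) :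
    miniwordList (L ++ [S]) = wordBefore a L ++ a :: t := by
  induction L with
  | nil => simp [miniwordList, wordBefore, hS]
  | cons B L ih =>
    simp only [List.cons_append, miniwordList, wordBefore, ih]
    cases wordBefore a L <;> simp [blockWord]

theorem blockWord_last (B : Finset (Fin (m + 1))) : blockWord (Fin.last m) B = B.sort (· ≤ ·) := by
  rw [blockWord, Finset.filter_false_of_mem fun x _ => (Fin.le_last x).not_gt,
    Finset.filter_true_of_mem fun x _ => Fin.le_last x, Finset.sort_empty, List.nil_append]

theorem wordBefore_last (L : List (Finset (Fin (m + 1)))) :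
    wordBefore (Fin.last m) L = miniwordList L := by
  induction L with
  | nil => rfl
  | cons B L ih =>
    simp only [miniwordList, wordBefore, ih]
    cases miniwordList L with
    | nil => simp [blockWord_last]
    | cons b w => simp [blockWord]

theorem val_sub_succ (x h : Fin (m + 1)) :
    (x - (h + 1)).val = if h < x then x.val - h.val - 1 else x.val + m - h.val := by
  induction h using Fin.lastCases with
  | last => simp [(Fin.le_last x).not_gt]
  | cast h =>
    rw [Fin.coeSucc_eq_succ, Fin.sub_def]
    simp only [Fin.val_succ, Fin.lt_def, Fin.val_castSucc]
    split_ifs with hlt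
    · rw [show m + 1 - (h.val + 1) + x.val = x.val - h.val - 1 + (m + 1) by omega,
        Nat.add_mod_right, Nat.mod_eq_of_lt (by omega)]
    · rw [Nat.mod_eq_of_lt (by omega)]
      omega

/-- Subtracting `h + 1` moves the letters larger than `h` in front of the others. -/
theorem sub_succ_lt_sub_succ_iff {x y h : Fin (m + 1)} :
    x - (h + 1) < y - (h + 1) ↔ ((h < x ↔ h < y) ∧ x < y) ∨ (h < x ∧ y ≤ h) := by
  rw [Fin.lt_def, val_sub_succ, val_sub_succ]
  have := x.isLt
  have := y.isLt
  simp only [Fin.lt_def, Fin.le_def] at *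
  split_ifs <;> omega

theorem coe_blockWord (h : Fin n) (B : Finset (Fin n)) :
    (blockWord h B : Multiset (Fin n)) = B.val := by
  simp only [blockWord, ← Multiset.coe_add, Finset.sort_eq, Finset.filter_val, ← not_lt]
  exact Multiset.filter_add_not _ _

theorem blockWord_map_sub_succ (h : Fin (m + 1)) (B : Finset (Fin (m + 1))) :
    (blockWord h B).map (· - (h + 1)) =
      (B.map (Equiv.subRight (h + 1)).toEmbedding).sort (· ≤ ·) := by
  have increasing : (blockWord h B).Pairwise (fun x y => x - (h + 1) < y - (h + 1)) := by
    simp only [sub_succ_lt_sub_succ_iff, blockWord, List.pairwise_append, Finset.mem_sort,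
      Finset.mem_filter]
    refine ⟨?_, ?_, fun x hx y hy => Or.inr ⟨hx.2, hy.2⟩⟩ <;>
      refine (Finset.sortedLT_sort _).pairwise.imp_of_mem
        fun {x y} hx hy hxy => Or.inl ⟨?_, hxy⟩ <;>
      simp only [Finset.mem_sort, Finset.mem_filter] at hx hy
    · exact iff_of_true hx.2 hy.2
    · exact iff_of_false hx.2.not_gt hy.2.not_gt
  refine List.Perm.eq_of_pairwise (le := (· < ·)) (fun x y _ _ hxy hyx => absurd hyx hxy.not_gt)
    (List.pairwise_map.2 increasing) (Finset.sortedLT_sort _).pairwise ?_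
  rw [← Multiset.coe_eq_coe, ← Multiset.map_coe, coe_blockWord, Finset.sort_eq]
  rfl

theorem blockWord_map_sub (c h : Fin (m + 1)) (B : Finset (Fin (m + 1))) :
    blockWord (h - c) (B.map (Equiv.subRight c).toEmbedding) = (blockWord h B).map (· - c) := by
  refine List.map_injective_iff.2 (sub_left_injective (b := h - c + 1)) ?_
  have hsub (x : Fin (m + 1)) : x - c - (h - c + 1) = x - (h + 1) := by abel
  rw [blockWord_map_sub_succ, List.map_map, Finset.map_map]
  simp only [Function.comp_def, hsub, blockWord_map_sub_succ]
  congr 2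
  exact DFunLike.ext _ _ hsub

theorem wordBefore_map_sub (c a : Fin (m + 1)) (L : List (Finset (Fin (m + 1)))) :
    wordBefore (a - c) (L.map fun B => B.map (Equiv.subRight c).toEmbedding) =
      (wordBefore a L).map (· - c) := by
  induction L with
  | nil => rfl
  | cons B L ih =>
    simp only [List.map_cons, wordBefore, ih, List.map_append, ← blockWord_map_sub]
    cases wordBefore a L <;> rfl

theorem countP_wordBefore (a : Fin n) (p : Fin n → Prop) [DecidablePred p]
    (L : List (Finset (Fin n))) :
    (wordBefore a L).countP p = (L.map fun B => (B.filter p).card).sum := by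
  induction L with
  | nil => rfl
  | cons B L ih =>
    have countP_block : (blockWord ((wordBefore a L).headD a) B).countP p = (B.filter p).card := by
      rw [← Multiset.coe_countP, coe_blockWord, Multiset.countP_eq_card_filter,
        ← Finset.filter_val, Finset.card_val]
    rw [wordBefore, List.countP_append, countP_block, ih, List.map_cons, List.sum_cons]

theorem majWord_append_pair (w : List (Fin n)) (x y : Fin n) :
    majWord (w ++ [x] ++ [y]) = majWord (w ++ [x]) + if y < x then w.length + 1 else 0 := by
  have getD_form (v : List (Fin n)) : majWord v = ∑ i ∈ Finset.range (v.length - 1),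
      if v.getD (i + 1) x < v.getD i x then i + 1 else 0 := by
    rw [← Fin.sum_univ_eq_sum_range
      (fun i => if v.getD (i + 1) x < v.getD i x then i + 1 else 0)]
    refine Finset.sum_congr rfl fun i _ => ?_
    rw [List.getD_eq_getElem _ _ (show i.val + 1 < v.length by omega),
      List.getD_eq_getElem _ _ (show i.val < v.length by omega)]
    rfl
  rw [getD_form, getD_form]
  simp only [List.length_append, List.length_singleton, Nat.add_sub_cancel, Finset.sum_range_succ]
  congr 1
  · refine Finset.sum_congr rfl fun i hi => ?_
    have hi := Finset.mem_range.1 hi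
    rw [List.getD_append (w ++ [x]) [y] x (i + 1) (by simp; omega),
      List.getD_append (w ++ [x]) [y] x i (by simp; omega)]
  · simp

theorem majWord_append_sorted (w : List (Fin n)) {t : List (Fin n)} {a : Fin n}
    (ht : (a :: t).Pairwise (· ≤ ·)) : majWord (w ++ a :: t) = majWord (w ++ [a]) := by
  induction t using List.reverseRecOn with
  | nil => rfl
  | append_singleton t y ih =>
    rw [← List.cons_append, List.pairwise_append] at ht
    rw [← ih ht.1]
    obtain ⟨u, x, hux⟩ := (List.eq_nil_or_concat' (a :: t)).resolve_left (List.cons_ne_nil a t)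
    have hxy : x ≤ y := ht.2.2 x (by simp [hux]) y (by simp)
    rw [← List.cons_append, hux, ← List.append_assoc, ← List.append_assoc, majWord_append_pair,
      if_neg hxy.not_gt, add_zero]

/-- Subtracting `a + 1` cyclically moves the descent at the end of each maximal run of letters
larger than `a` to the beginning of that run, so it lowers `maj` by the length of the run; the
conditional term supplies the end of a run that reaches the last letter. -/
theorem majWord_add_eq_countP_add_majWord_map_sub (a : Fin (m + 1)) (w : List (Fin (m + 1)))
    (x : Fin (m + 1)) :
    majWord (w ++ [x]) + (if a < x then w.length + 1 else 0) =
      (w ++ [x]).countP (fun y => a < y) + majWord ((w ++ [x]).map (· - (a + 1))) := by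
  induction w using List.reverseRecOn generalizing x with
  | nil =>
    have majWord_singleton (y : Fin (m + 1)) : majWord [y] = 0 := rfl
    by_cases h : a < x <;> simp [h, majWord_singleton]
  | append_singleton w z ih =>
    have boundary (l : ℕ) : ((if x < z then l else 0) + if a < x then l else 0) =
        (if x - (a + 1) < z - (a + 1) then l else 0) + if a < z then l else 0 := by
      simp only [sub_succ_lt_sub_succ_iff]
      simp only [Fin.lt_def, Fin.le_def]
      split_ifs <;> omega
    have h_boundary := boundary (w.length + 1)
    have hz := ih z
    have hx : (if a < x then w.length + 1 + 1 else 0) =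
        (if a < x then w.length + 1 else 0) + if a < x then 1 else 0 := by
      split_ifs <;> rfl
    simp only [List.map_append, List.map_singleton, majWord_append_pair, List.countP_append,
      List.countP_singleton, List.length_append, List.length_singleton, List.length_map,
      decide_eq_true_eq] at hz ⊢
    omega

theorem majWord_append_singleton (a : Fin (m + 1)) (w : List (Fin (m + 1))) :
    majWord (w ++ [a]) = w.countP (fun y => a < y) + majWord (w.map (· - (a + 1))) := by
  rcases List.eq_nil_or_concat' w with rfl | ⟨u, x, rfl⟩
  · rfl
  · rw [majWord_append_pair, majWord_add_eq_countP_add_majWord_map_sub]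

theorem minimaj_snoc {k : ℕ} (π : Fin k → Finset (Fin (m + 1))) {S : Finset (Fin (m + 1))}
    (hS : S.Nonempty) :
    minimaj (Fin.snoc π S : Fin (k + 1) → Finset (Fin (m + 1))) =
      ∑ i, ((π i).filter (fun x => S.min' hS < x)).card +
        minimaj fun i => (π i).map (Equiv.subRight (S.min' hS + 1)).toEmbedding := by
  obtain ⟨a, t, hat⟩ := List.exists_cons_of_length_pos
    ((S.length_sort (· ≤ ·)).symm ▸ hS.card_pos)
  have hmin : S.min' hS = a := by
    rw [Finset.min'_eq_sorted_zero]
    simp only [hat, List.getElem_cons_zero]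
  have miniword_snoc : miniword (Fin.snoc π S : Fin (k + 1) → Finset (Fin (m + 1))) =
      wordBefore a (List.ofFn π) ++ a :: t := by
    rw [miniword, List.ofFn_succ', List.concat_eq_append]
    simp only [Fin.snoc_castSucc, Fin.snoc_last]
    exact miniwordList_append_singleton hat _
  have miniword_map_sub :
      miniword (fun i => (π i).map (Equiv.subRight (a + 1)).toEmbedding) =
        (wordBefore a (List.ofFn π)).map (· - (a + 1)) := by
    have sub_eq_last : a - (a + 1) = Fin.last m := by
      rw [sub_add_cancel_left, eq_comm, eq_neg_iff_add_eq_zero, Fin.last_add_one]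
    rw [← wordBefore_map_sub, sub_eq_last, wordBefore_last, miniword, List.map_ofFn]
    rfl
  rw [hmin, minimaj, minimaj, miniword_snoc, miniword_map_sub,
    majWord_append_sorted _ (hat ▸ S.pairwise_sort (· ≤ ·)), majWord_append_singleton,
    countP_wordBefore, List.map_ofFn, List.sum_ofFn]
  rfl

theorem inv_snoc {k : ℕ} (π : Fin k → Finset (Fin n)) {S : Finset (Fin n)} (hS : S.Nonempty) :
    inv (Fin.snoc π S : Fin (k + 1) → Finset (Fin n)) =
      ∑ i, ((π i).filter (fun x => S.min' hS < x)).card + inv π := by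
  have min_eq_coe_iff (y : Fin n) : S.min = (y : WithTop (Fin n)) ↔ y = S.min' hS := by
    rw [← Finset.coe_min' hS, WithTop.coe_inj, eq_comm]
  have not_last_lt (i : Fin k) : ¬ Fin.last k < i.castSucc := (Fin.le_last _).not_gt
  have card_filter_eq (i : Fin k) : ((π i).filter (fun x => S.min' hS < x)).card =
      ∑ x, ∑ y, if x ∈ π i ∧ y = S.min' hS ∧ y < x then 1 else 0 := by
    simp only [Finset.card_filter, ite_and, Finset.sum_ite_mem, Finset.sum_ite_irrel,
      Finset.sum_const_zero, Finset.sum_ite_eq', Finset.univ_inter, Finset.mem_univ, if_true]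
  simp only [card_filter_eq, inv, Finset.card_filter, Fintype.sum_prod_type,
    Fin.sum_univ_castSucc, Fin.snoc_castSucc, Fin.snoc_last, Fin.castSucc_lt_castSucc_iff,
    Fin.castSucc_lt_last, min_eq_coe_iff, not_last_lt, lt_irrefl, false_and, if_false, true_and,
    Finset.sum_const_zero, add_zero, Finset.sum_add_distrib]
  rw [add_comm]

end Words

section GeneratingFunctions

variable {k : ℕ} {σ R : Type*}

section CommSemiring

variable [CommSemiring R] [Fintype σ]

section DecidableEq

variable [DecidableEq σ]

/-- The generating polynomial of a statistic over the sequences of `k` nonempty blocks whose last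
block is contained in `s`, recording the statistic by powers of `q` and the letters by monomials. -/
noncomputable def partitionGen (q : R) (s : Finset σ) (stat : (Fin k → Finset σ) → ℕ) :
    MvPolynomial σ R :=
  ∑ π : Fin k → Finset σ with
    (∀ i, (π i).Nonempty) ∧ ∀ i : Fin k, i.val + 1 = k → π i ⊆ s,
    q ^ stat π • ∏ i, blockMonomial R (π i)

theorem partitionGen_univ (q : R) (stat : (Fin k → Finset σ) → ℕ) :
    partitionGen q Finset.univ stat =
      ∑ π with ∀ i, (π i).Nonempty, q ^ stat π • ∏ i, blockMonomial R (π i) := by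
  simp only [partitionGen, Finset.subset_univ, implies_true, and_true]

theorem partitionGen_univ_zero (q : R) (stat : (Fin 0 → Finset σ) → ℕ)
    (hstat : ∀ π, stat π = 0) : partitionGen q Finset.univ stat = 1 := by
  simp only [partitionGen_univ, IsEmpty.forall_iff, Finset.filter_true, Finset.univ_unique,
    Finset.sum_singleton, Finset.univ_eq_empty, Finset.prod_empty, hstat, pow_zero, one_smul]

theorem rename_partitionGen_univ (q : R) (e : Equiv.Perm σ)
    (stat : (Fin k → Finset σ) → ℕ) :
    MvPolynomial.rename e
      (partitionGen q Finset.univ fun π => stat fun i => (π i).map e.toEmbedding) =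
      partitionGen q Finset.univ stat := by
  simp only [partitionGen_univ, map_sum, map_smul, map_prod, ← e.coe_toEmbedding,
    rename_blockMonomial]
  let relabel : (Fin k → Finset σ) ≃ (Fin k → Finset σ) :=
    Equiv.piCongrRight fun _ => e.finsetCongr
  refine Finset.sum_equiv relabel (fun π => ?_) fun π _ => rfl
  simp [relabel]

theorem partitionGen_map_of_isSymmetric {q : R} {stat : (Fin k → Finset σ) → ℕ}
    (h : (partitionGen q Finset.univ stat).IsSymmetric) (e : Equiv.Perm σ) :
    (partitionGen q Finset.univ fun π => stat fun i => (π i).map e.toEmbedding) =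
      partitionGen q Finset.univ stat :=
  MvPolynomial.rename_injective e e.injective ((rename_partitionGen_univ q e stat).trans (h e).symm)

theorem partitionGen_eq_sum_snoc (q : R) (s : Finset σ)
    (stat : (Fin (k + 1) → Finset σ) → ℕ) :
    partitionGen q s stat = ∑ S ∈ s.powerset with S.Nonempty, blockMonomial R S *
      ∑ π : Fin k → Finset σ with ∀ i, (π i).Nonempty,
        q ^ stat (Fin.snoc π S) • ∏ i, blockMonomial R (π i) := by
  have blocks_snoc (S : Finset σ) (π : Fin k → Finset σ) :
      ((∀ i, ((Fin.snoc π S : Fin (k + 1) → Finset σ) i).Nonempty) ∧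
        ∀ i : Fin (k + 1), i.val + 1 = k + 1 →
          (Fin.snoc π S : Fin (k + 1) → Finset σ) i ⊆ s) ↔
        (S ∈ s.powerset ∧ S.Nonempty) ∧ ∀ i, (π i).Nonempty := by
    simp only [Fin.forall_fin_succ', Fin.snoc_castSucc, Fin.snoc_last, Fin.val_last,
      Fin.val_castSucc, add_left_inj, (Fin.is_lt _).ne, IsEmpty.forall_iff, implies_true,
      true_and, forall_const, Finset.mem_powerset]
    tauto
  have snocEquiv_apply (S : Finset σ) (π : Fin k → Finset σ) :
      Fin.snocEquiv (fun _ => Finset σ) (S, π) = Fin.snoc π S := rfl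
  rw [partitionGen, Finset.sum_filter, ← (Fin.snocEquiv fun _ => Finset σ).sum_comp,
    Fintype.sum_prod_type]
  simp only [snocEquiv_apply, blocks_snoc, ite_and]
  simp only [Finset.sum_ite_irrel, Finset.sum_const_zero, Fin.prod_univ_castSucc,
    Fin.snoc_castSucc, Fin.snoc_last, ← Finset.sum_filter, Finset.filter_univ_mem]
  refine Finset.sum_congr rfl fun S _ => ?_
  rw [Finset.mul_sum]
  exact Finset.sum_congr rfl fun π _ => by rw [mul_smul_comm, mul_comm]

theorem coeff_partitionGen (q : R) (s : Finset σ) (stat : (Fin k → Finset σ) → ℕ)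
    (A : Multiset σ) :
    (partitionGen q s stat).coeff (Multiset.toFinsupp A) =
      ∑ π with ((∀ i, (π i).Nonempty) ∧ ∑ i, (π i).val = A) ∧
        ∀ i : Fin k, i.val + 1 = k → π i ⊆ s, q ^ stat π := by
  simp only [partitionGen, MvPolynomial.coeff_sum, MvPolynomial.coeff_smul, prod_blockMonomial,
    MvPolynomial.coeff_monomial, EmbeddingLike.apply_eq_iff_eq, smul_eq_mul, mul_ite, mul_one,
    mul_zero, ← Finset.sum_filter, Finset.filter_filter, and_right_comm]

end DecidableEq

theorem partitionGen_succ [LinearOrder σ] {q : R} {s : Finset σ} (hs : IsUpperSet (s : Set σ))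
    {stat' : (Fin (k + 1) → Finset σ) → ℕ} {stat : σ → (Fin k → Finset σ) → ℕ}
    {F : MvPolynomial σ R}
    (hsnoc : ∀ (π : Fin k → Finset σ) {S : Finset σ} (hS : S.Nonempty),
      stat' (Fin.snoc π S) =
        ∑ i, ((π i).filter (fun x => S.min' hS < x)).card + stat (S.min' hS) π)
    (hstat : ∀ a, partitionGen q Finset.univ (stat a) = F) :
    partitionGen q s stat' = appendBlock q s F := by
  rw [partitionGen_eq_sum_snoc, appendBlock_apply]
  refine Finset.sum_congr rfl fun S hS => congrArg _ ?_
  obtain ⟨hSs, hne⟩ := Finset.mem_filter.1 hS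
  have larger_letters :
      s.filter (fun j : σ => S.min < j) = Finset.univ.filter (S.min' hne < ·) := by
    ext j
    simp only [Finset.mem_filter, Finset.mem_univ, true_and, ← Finset.coe_min' hne,
      WithTop.coe_lt_coe, and_iff_right_iff_imp]
    exact fun hj => hs hj.le (Finset.mem_powerset.1 hSs (S.min'_mem hne))
  rw [larger_letters, ← hstat (S.min' hne), partitionGen_univ, map_sum]
  refine Finset.sum_congr rfl fun π _ => ?_
  simp only [map_smul, scale_prod_blockMonomial, Finset.mem_filter, Finset.mem_univ, true_and,
    hsnoc π hne, smul_smul, ← pow_add, add_comm]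

theorem partitionGen_inv_succ {n : ℕ} (q : R) (k : ℕ) {s : Finset (Fin n)}
    (hs : IsUpperSet (s : Set (Fin n))) :
    partitionGen q s (inv (k := k + 1)) =
      appendBlock q s (partitionGen q Finset.univ (inv (k := k))) :=
  partitionGen_succ hs inv_snoc fun _ => rfl

theorem partitionGen_minimaj_succ_of_isSymmetric {m k : ℕ} {q : R}
    (h : (partitionGen q Finset.univ (minimaj (n := m + 1) (k := k))).IsSymmetric)
    {s : Finset (Fin (m + 1))} (hs : IsUpperSet (s : Set (Fin (m + 1)))) :
    partitionGen q s (minimaj (k := k + 1)) =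
      appendBlock q s (partitionGen q Finset.univ (minimaj (k := k))) :=
  partitionGen_succ hs
    (stat := fun a π => minimaj fun i => (π i).map (Equiv.subRight (a + 1)).toEmbedding)
    minimaj_snoc fun a => partitionGen_map_of_isSymmetric h (Equiv.subRight (a + 1))

end CommSemiring

section IsDomain

variable {m : ℕ} [CommRing R] [IsDomain R] {q : R}

theorem partitionGen_univ_minimaj (hq : q ≠ 0) (k : ℕ) :
    partitionGen q Finset.univ (minimaj (n := m + 1) (k := k)) = blockGen q k := by
  induction k with
  | zero => exact partitionGen_univ_zero q minimaj fun _ => rfl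
  | succ k ih =>
    rw [partitionGen_minimaj_succ_of_isSymmetric (ih ▸ isSymmetric_blockGen hq k)
      (Finset.coe_univ (α := Fin (m + 1)) ▸ isUpperSet_univ), ih, blockGen]

theorem partitionGen_minimaj_succ (hq : q ≠ 0) (k : ℕ) {s : Finset (Fin (m + 1))}
    (hs : IsUpperSet (s : Set (Fin (m + 1)))) :
    partitionGen q s (minimaj (k := k + 1)) =
      appendBlock q s (partitionGen q Finset.univ (minimaj (k := k))) :=
  partitionGen_minimaj_succ_of_isSymmetric
    (partitionGen_univ_minimaj hq k ▸ isSymmetric_blockGen hq k) hs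

end IsDomain
end GeneratingFunctions

section Coefficients

variable {m k : ℕ} {R : Type*} [CommSemiring R]

theorem toFinsupp_multisetA_apply (r : ℕ) (β : Fin m → ℕ) (i : Fin (m + 1)) :
    Multiset.toFinsupp (multisetA r β) i = (Fin.cons r β : Fin (m + 1) → ℕ) i := by
  rw [Multiset.toFinsupp_apply, multisetA, Multiset.count_add, Multiset.count_sum']
  cases i using Fin.cases <;> simp [Multiset.count_replicate, (Fin.succ_ne_zero _).symm]

theorem toFinsupp_map_succ_apply (S : Finset (Fin m)) (i : Fin (m + 1)) :
    Multiset.toFinsupp (S.map (Fin.succEmb m)).val i =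
      (Fin.cons 0 (chi S) : Fin (m + 1) → ℕ) i := by
  rw [Multiset.toFinsupp_apply, Multiset.count_eq_of_nodup (Finset.nodup _)]
  cases i using Fin.cases <;> simp [chi, Fin.succ_ne_zero]

theorem toFinsupp_map_succ_le_multisetA_iff (r : ℕ) (β : Fin m → ℕ) (S : Finset (Fin m)) :
    Multiset.toFinsupp (S.map (Fin.succEmb m)).val ≤ Multiset.toFinsupp (multisetA r β) ↔
      ∀ i, chi S i ≤ β i := by
  simp only [Finsupp.le_def, toFinsupp_multisetA_apply, toFinsupp_map_succ_apply,
    Fin.forall_fin_succ, Fin.cons_zero, Fin.cons_succ, zero_le, true_and]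

theorem toFinsupp_multisetA_sub (r : ℕ) (β : Fin m → ℕ) (S : Finset (Fin m)) :
    Multiset.toFinsupp (multisetA r β) - Multiset.toFinsupp (S.map (Fin.succEmb m)).val =
      Multiset.toFinsupp (multisetA r (β - chi S)) := by
  ext i
  rw [Finsupp.tsub_apply]
  simp only [toFinsupp_multisetA_apply, toFinsupp_map_succ_apply]
  cases i using Fin.cases <;> simp

theorem coeff_appendBlock {σ : Type*} [LinearOrder σ] (q : R) (s : Finset σ)
    (F : MvPolynomial σ R) (d : σ →₀ ℕ) :
    (appendBlock q s F).coeff d =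
      ∑ S ∈ s.powerset with S.Nonempty ∧ Multiset.toFinsupp S.val ≤ d,
        q ^ (∑ i ∈ s with S.min < WithTop.some i, (d - Multiset.toFinsupp S.val) i) *
          F.coeff (d - Multiset.toFinsupp S.val) := by
  simp only [appendBlock_apply, MvPolynomial.coeff_sum, blockMonomial_eq_monomial,
    MvPolynomial.coeff_monomial_mul', one_mul, coeff_scale, ← Finset.sum_filter,
    Finset.filter_filter]

theorem sum_powerset_map {α β M : Type*} [AddCommMonoid M] (f : α ↪ β) (s : Finset α)
    (g : Finset β → M) :
    ∑ S ∈ (s.map f).powerset, g S = ∑ S ∈ s.powerset, g (S.map f) := by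
  have powerset_map : (s.map f).powerset = s.powerset.map (Finset.mapEmbedding f).toEmbedding := by
    ext S
    simp [Finset.subset_map_iff, Finset.mapEmbedding_apply, eq_comm]
  rw [powerset_map, Finset.sum_map]
  rfl

theorem coeff_appendBlock_compl_zero (q : R) (r : ℕ) (β : Fin m → ℕ)
    (F : MvPolynomial (Fin (m + 1)) R) :
    (appendBlock q {0}ᶜ F).coeff (Multiset.toFinsupp (multisetA r β)) =
      ∑ S : Finset (Fin m) with S.Nonempty ∧ ∀ i, chi S i ≤ β i,
        q ^ lastBlockExponent β S * F.coeff (Multiset.toFinsupp (multisetA r (β - chi S))) := by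
  have compl_zero : ({0}ᶜ : Finset (Fin (m + 1))) = Finset.univ.map (Fin.succEmb m) := by
    rw [← Fin.image_succ_univ, Finset.map_eq_image, Fin.coe_succEmb]
  have larger_letters (S : Finset (Fin m)) :
      ∑ i ∈ Finset.univ.map (Fin.succEmb m) with (S.map (Fin.succEmb m)).min < WithTop.some i,
        Multiset.toFinsupp (multisetA r (β - chi S)) i = lastBlockExponent β S := by
    have min_lt_iff (i : Fin m) :
        (S.map (Fin.succEmb m)).min < WithTop.some i.succ ↔ S.min < WithTop.some i := by
      simp [Finset.min, Finset.inf_lt_iff]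
    rw [lastBlockExponent, Finset.sum_filter, Finset.sum_map, Finset.sum_filter]
    simp only [Fin.coe_succEmb, min_lt_iff, toFinsupp_multisetA_apply, Fin.cons_succ,
      Pi.sub_apply]
  rw [coeff_appendBlock, compl_zero, Finset.sum_filter, sum_powerset_map, Finset.powerset_univ,
    Finset.sum_filter]
  simp only [Finset.map_nonempty, toFinsupp_map_succ_le_multisetA_iff, toFinsupp_multisetA_sub,
    larger_letters]

theorem coeff_partitionGen_univ (q : R) (stat : (Fin k → Finset (Fin (m + 1))) → ℕ)
    (r : ℕ) (β : Fin m → ℕ) :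
    (partitionGen q Finset.univ stat).coeff (Multiset.toFinsupp (multisetA r β)) =
      ∑ π with IsPartitionAll r β π, q ^ stat π := by
  simp only [coeff_partitionGen, Finset.subset_univ, implies_true, and_true, IsPartitionAll]

theorem coeff_partitionGen_compl_zero (q : R) (stat : (Fin k → Finset (Fin (m + 1))) → ℕ)
    (r : ℕ) (β : Fin m → ℕ) :
    (partitionGen q {0}ᶜ stat).coeff (Multiset.toFinsupp (multisetA r β)) =
      ∑ π with IsPartition r β π, q ^ stat π := by
  rw [coeff_partitionGen]
  simp only [Finset.subset_compl_singleton]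
  rfl

theorem isUpperSet_compl_zero :
    IsUpperSet (({0}ᶜ : Finset (Fin (m + 1))) : Set (Fin (m + 1))) := by
  rw [Finset.coe_compl, Finset.coe_singleton, isUpperSet_compl]
  rintro _ i hi rfl
  exact Fin.le_zero_iff.1 hi

theorem sum_isPartition_eq_sum_isPartitionAll {q : R}
    {stat' : (Fin (k + 1) → Finset (Fin (m + 1))) → ℕ}
    {stat : (Fin k → Finset (Fin (m + 1))) → ℕ}
    (h : partitionGen q {0}ᶜ stat' = appendBlock q {0}ᶜ (partitionGen q Finset.univ stat))
    (r : ℕ) (β : Fin m → ℕ) :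
    ∑ π with IsPartition r β π, q ^ stat' π =
      ∑ S : Finset (Fin m) with S.Nonempty ∧ ∀ i, chi S i ≤ β i,
        q ^ lastBlockExponent β S * ∑ π with IsPartitionAll r (β - chi S) π, q ^ stat π := by
  rw [← coeff_partitionGen_compl_zero, h, coeff_appendBlock_compl_zero]
  simp only [coeff_partitionGen_univ]

end Coefficients

end OMP

theorem mainTheorem6 (m r k : ℕ) (hk : 1 ≤ k) (β : Fin m → ℕ) :
    OMP.M r β k =
      ∑ S : Finset (Fin m) with S.Nonempty ∧ (∀ i, OMP.chi S i ≤ β i),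
        Polynomial.X ^ OMP.lastBlockExponent β S * OMP.Mall r (β - OMP.chi S) (k - 1) ∧
    OMP.I r β k =
      ∑ S : Finset (Fin m) with S.Nonempty ∧ (∀ i, OMP.chi S i ≤ β i),
        Polynomial.X ^ OMP.lastBlockExponent β S * OMP.Iall r (β - OMP.chi S) (k - 1) := by
  obtain ⟨k, rfl⟩ := Nat.exists_eq_add_of_le' hk
  refine ⟨?_, OMP.sum_isPartition_eq_sum_isPartitionAll
    (OMP.partitionGen_inv_succ Polynomial.X k OMP.isUpperSet_compl_zero) r β⟩
  apply Polynomial.map_injective (Nat.castRingHom ℤ) Nat.cast_injective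
  simp only [OMP.M, OMP.Mall, Polynomial.map_sum, Polynomial.map_mul, Polynomial.map_pow,
    Polynomial.map_X]
  exact OMP.sum_isPartition_eq_sum_isPartitionAll
    (OMP.partitionGen_minimaj_succ Polynomial.X_ne_zero k OMP.isUpperSet_compl_zero) r β
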